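/- Theorem. For $k\ge 0$ let $op_{[2^k]}(123)$ be the number of ordered set partitions $B_1/B_2/\cdots/B_k$ of $\{1,\dots,2k\}$ into $k$ blocks of size $2$ that avoid the pattern $123$, i.e. for which there are no indices $i_1<i_2<i_3$ and elements $b_1\in B_{i_1}$, $b_2\in B_{i_2}$, $b_3\in B_{i_3}$ with $b_1<b_2<b_3$. Let $$Q(x)=\sum_{k\ge 0} op_{[2^k]}(123)\,x^{2k}$$ as a formal power series. Then $$\begin{aligned} &\left(\tfrac{21}{2}x^7+\tfrac{329}{8}x^5-\tfrac72x^3\right)Q'''(x)+\left(99x^6+\tfrac{1443}{8}x^4-5x^2\right)Q''(x)\\ &\qquad+\left(207x^5+\tfrac{717}{8}x^3+11x\right)Q'(x)+\left(72x^4-12x^2\right)Q(x)=0, \end{aligned}$$ and, for every integer $k\ge 0$, $$op_{[2^{k+2}]}(123)=\frac{329k^3+1215k^2+1426k+528}{2(k+2)(2k+5)(7k+5)}\,op_{[2^{k+1}]}(123)+\frac{3(k+1)(2k+1)(7k+12)}{(k+2)(2k+5)(7k+5)}\,op_{[2^k]}(123).$$ (The recurrence was conjectured by Godbole, Goyt,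 Herdan and Pudwell.) -/

import Mathlib

namespace OrderedSetPartition

/-- `B 0 / B 1 / ⋯ / B (k-1)` is an ordered partition of an `n`-element chain
(`Fin n` plays the role of `{1 < 2 < ⋯ < n}`): the blocks are nonempty, pairwise disjoint, and
cover the whole set; their linear order is that of the indices. -/
structure IsOrderedPartition {n k : ℕ} (B : Fin k → Finset (Fin n)) : Prop where
  nonempty : ∀ i, (B i).Nonempty
  disjoint : ∀ i j, i ≠ j → Disjoint (B i) (B j)
  cover : ∀ x, ∃ i, x ∈ B i

/-- `B` contains the pattern `σ`: one can choose blocks with increasing indices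
`i 0 < ⋯ < i (m-1)`, and elements `b j` in them, so that `b 0 b 1 ⋯ b (m-1)` is
order-isomorphic to `σ 0 σ 1 ⋯ σ (m-1)`. -/
def Contains {n k m : ℕ} (B : Fin k → Finset (Fin n)) (σ : Equiv.Perm (Fin m)) : Prop :=
  ∃ (i : Fin m → Fin k) (b : Fin m → Fin n),
    StrictMono i ∧ (∀ j, b j ∈ B (i j)) ∧ ∀ j l, b j < b l ↔ σ j < σ l

/-- The ordered partitions of `{1, …, n}` whose `i`-th block has `s i` elements and which
avoid the pattern `σ`. -/
def avoiding {k m : ℕ} (n : ℕ) (s : Fin k → ℕ) (σ : Equiv.Perm (Fin m)) :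
    Set (Fin k → Finset (Fin n)) :=
  {B | IsOrderedPartition B ∧ (∀ i, (B i).card = s i) ∧ ¬ Contains B σ}

/-- The number of `σ`-avoiding ordered partitions of `{1, …, s 0 + ⋯ + s (k-1)}` with block
sizes `s 0, …, s (k-1)`, in this order. -/
noncomputable def op {k m : ℕ} (s : Fin k → ℕ) (σ : Equiv.Perm (Fin m)) : ℕ :=
  (avoiding (∑ i, s i) s σ).ncard

/-- The pattern `123`. -/
def pattern123 : Equiv.Perm (Fin 3) := Equiv.refl (Fin 3)

/-- The number of `123`-avoiding ordered partitions of `{1, …, 2k}` into `k` blocks of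
size `2`. -/
noncomputable def opTwo (k : ℕ) : ℕ := op (fun _ : Fin k => 2) pattern123

/-- The generating function `Q(x) = ∑ₖ opTwo k * x ^ (2k)`, a formal power series. -/
noncomputable def Q : PowerSeries ℚ :=
  PowerSeries.mk fun m => if Even m then (opTwo (m / 2) : ℚ) else 0

end OrderedSetPartition

/-! Record a partition as the word whose letter at position `x` is the index of the block containing
`x`; avoiding 123 then means that the word has no strictly increasing subsequence of length three.
Such words grow by inserting two copies of a new largest letter (`avoids123_insert_iff`): what
precedes the later copy must be weakly decreasing. Hence the length of the longest weakly decreasing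
prefix governs the whole process (`sum_words_succ`).

Summing binomial coefficients of this length turns the insertion rule into a recurrence with
constant coefficients in the lower index `i`, apart from two boundary equations. The kernel method
solves it: the generating functions follow a second-order linear recurrence in `i`, given by the two
roots of the kernel that vanish at `X = 0`. Everything is rational in one algebraic series `T`, and
the series `q` of `opTwo` satisfies a biquadratic equation (`opTwo_algebraic`).

By that equation the derivatives of `q` lie in the span of `q` and `q ^ 3` over the rational
functions; eliminating `q ^ 3` gives a differential equation. Its coefficients give the recurrence,
which in turn gives the equation for `Q`, the series `q` evaluated at the square of the variable. -/

namespace OrderedSetPartition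

/-! ### Words and insertion of the largest letter -/

/-- No three entries of the word, read from left to right, are strictly increasing. -/
def Avoids123 (w : List ℕ) : Prop :=
  ∀ a b c, a < b → b < c → ¬ [a, b, c].Sublist w

/-- The length of the longest weakly decreasing prefix of a word. -/
def descPrefix : List ℕ → ℕ
  | [] => 0
  | [_] => 1
  | a :: b :: l => if b ≤ a then descPrefix (b :: l) + 1 else 1

theorem le_descPrefix_iff (w : List ℕ) (s : ℕ) :
    s ≤ descPrefix w ↔ s ≤ w.length ∧ (w.take s).Pairwise (· ≥ ·) := by
  simp only [← List.isChain_iff_pairwise]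
  induction w using descPrefix.induct generalizing s with
  | case1 => simp [descPrefix]
  | case2 a =>
    rcases s with _ | s <;> simp [descPrefix]
  | case3 a b l h ih =>
    rcases s with _ | _ | s
    · simp
    · simp only [descPrefix, h, if_true]
      simp
    · have := ih (s + 1)
      simp [descPrefix, h] at this ⊢
      exact this
  | case4 a b l h =>
    rcases s with _ | _ | s
    · simp
    · simp [descPrefix, h]
    · simp [descPrefix, h]

theorem descPrefix_append_cons {k : ℕ} {x : List ℕ} (l : List ℕ) (hx : x ≠ [])
    (hd : x.Pairwise (· ≥ ·)) (hk : ∀ a ∈ x, a < k) :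
    descPrefix (x ++ k :: l) = x.length := by
  induction x with
  | nil => exact absurd rfl hx
  | cons a x ih =>
    rcases x with _ | ⟨b, x⟩
    · have : a < k := hk a (by simp)
      simp [descPrefix, this]
    · have h := ih (by simp) hd.of_cons (fun c hc => hk c (by simp [hc]))
      have hab : b ≤ a := List.rel_of_pairwise_cons hd (by simp)
      simp only [List.cons_append] at h
      simp [descPrefix, hab, h]

theorem descPrefix_cons {k : ℕ} {l : List ℕ} (hk : ∀ a ∈ l, a ≤ k) :
    descPrefix (k :: l) = descPrefix l + 1 := by
  rcases l with _ | ⟨b, l⟩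
  · rfl
  · have : b ≤ k := hk b (by simp)
    simp [descPrefix, this]

/-- Insert the letter `k` into `w` after the first `r` and after the first `s` letters. -/
def insertTwo (k : ℕ) (w : List ℕ) (s r : ℕ) : List ℕ :=
  (w.take s).take r ++ k :: ((w.take s).drop r ++ k :: w.drop s)

/-- The `123`-avoiding words containing each of the letters `0, …, k - 1` twice, generated by
inserting the letters in increasing order. -/
def words : ℕ → Finset (List ℕ)
  | 0 => {[]}
  | k + 1 => ((words k).sigma fun w => (Finset.range (descPrefix w + 1)).sigma fun s =>
      Finset.range (s + 1)).image fun p => insertTwo k p.1 p.2.1 p.2.2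

/-- As `k` exceeds all other letters, it can only be the top of an increasing triple. The later copy
sees the most letters before it, so the only new condition is that `x ++ y` has no ascent. -/
theorem avoids123_insert_iff {k : ℕ} {x y z : List ℕ} (hx : ∀ a ∈ x, a < k)
    (hy : ∀ a ∈ y, a < k) (hz : ∀ a ∈ z, a < k) :
    Avoids123 (x ++ k :: (y ++ k :: z)) ↔
      Avoids123 (x ++ y ++ z) ∧ (x ++ y).Pairwise (· ≥ ·) := by
  have fx : x.filter (· ≠ k) = x := List.filter_eq_self.2 fun a ha => by simpa using (hx a ha).ne
  have fy : y.filter (· ≠ k) = y := List.filter_eq_self.2 fun a ha => by simpa using (hy a ha).ne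
  have fz : z.filter (· ≠ k) = z := List.filter_eq_self.2 fun a ha => by simpa using (hz a ha).ne
  have hle : ∀ a ∈ x ++ k :: (y ++ k :: z), a ≤ k := by
    intro a ha
    simp only [List.mem_append, List.mem_cons] at ha
    rcases ha with h | h | h | h | h
    · exact (hx a h).le
    · exact h.le
    · exact (hy a h).le
    · exact h.le
    · exact (hz a h).le
  constructor
  · intro h
    refine ⟨fun a b c hab hbc hs => h a b c hab hbc (hs.trans ?_), ?_⟩
    · rw [List.append_assoc]
      exact List.Sublist.append (List.Sublist.refl x)
        (((List.Sublist.refl y).append (List.sublist_cons_self k z)).trans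
          (List.sublist_cons_self _ _))
    · rw [List.pairwise_iff_forall_sublist]
      intro a b hs
      by_contra hab
      have hb : b ∈ x ++ y := hs.subset (by simp)
      have hbk : b < k := (List.mem_append.1 hb).elim (hx b) (hy b)
      refine h a b k (by omega) hbk ?_
      have h1 : ([a, b] ++ [k]).Sublist ((x ++ y) ++ k :: z) :=
        hs.append (by simp)
      refine h1.trans ?_
      rw [List.append_assoc]
      exact (List.Sublist.refl x).append (List.sublist_cons_self _ _)
  · rintro ⟨h, hd⟩ a b c hab hbc hs
    have hck : c ≤ k := hle c (hs.subset (by simp))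
    rcases hck.lt_or_eq with hc | rfl
    · refine h a b c hab hbc ?_
      have h1 := hs.filter (· ≠ k)
      have e1 : [a, b, c].filter (· ≠ k) = [a, b, c] := by
        rw [List.filter_eq_self]
        intro d hd
        simp only [List.mem_cons, List.not_mem_nil, or_false] at hd
        have : d < k := by omega
        simpa using this.ne
      rw [e1] at h1
      simpa only [List.filter_append, List.filter_cons, fx, fy, fz, ne_eq, not_true_eq_false,
        decide_false, Bool.false_eq_true, if_false, List.append_assoc] using h1
    · have h1 : ([a, b] ++ [c]).Sublist ((x ++ c :: y) ++ c :: z) := by simpa using hs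
      obtain ⟨l₁, l₂, hl, hl₁, hl₂⟩ := List.append_sublist_iff.1 h1
      -- The top letter is matched in `l₂`, and `z` does not contain it, so `l₁` ends before the
      -- later copy.
      have hc2 : c ∈ l₂ := hl₂.subset (by simp)
      have h2 : l₁.Sublist (x ++ c :: y) := by
        rcases List.append_eq_append_iff.1 hl with ⟨u, hu, hv⟩ | ⟨u, hu, -⟩
        · rcases u with _ | ⟨d, u⟩
          · simp [hu]
          · have : c ∈ z := by
              simp only [List.cons_append, List.cons.injEq] at hv
              rw [hv.2]
              exact List.mem_append_right _ hc2
            exact absurd (hz c this) (lt_irrefl _)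
        · rw [hu]; exact List.sublist_append_left _ _
      have h3 := (hl₁.trans h2).filter (· ≠ c)
      have e1 : [a, b].filter (· ≠ c) = [a, b] := by
        rw [List.filter_eq_self]
        intro d hd
        simp only [List.mem_cons, List.not_mem_nil, or_false] at hd
        have : d < c := by omega
        simpa using this.ne
      rw [e1] at h3
      simp only [List.filter_append, List.filter_cons, fx, fy, ne_eq, not_true_eq_false,
        decide_false, Bool.false_eq_true, if_false] at h3
      have := (List.pairwise_iff_forall_sublist.1 hd) h3
      omega

theorem mem_words {k : ℕ} {w : List ℕ} :
    w ∈ words k ↔ (∀ a, w.count a = if a < k then 2 else 0) ∧ Avoids123 w := by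
  induction k generalizing w with
  | zero =>
    simp only [words, Finset.mem_singleton, not_lt_zero, if_false, List.count_eq_zero]
    constructor
    · rintro rfl
      refine ⟨by simp, fun a b c _ _ h => by simp at h⟩
    · exact fun h => List.eq_nil_iff_forall_not_mem.2 h.1
  | succ k ih =>
    have hlt : ∀ {v : List ℕ}, (∀ a, v.count a = if a < k then 2 else 0) → ∀ a ∈ v, a < k := by
      intro v hv a ha
      by_contra h
      have := hv a
      rw [if_neg h] at this
      exact List.count_eq_zero.1 this ha
    constructor
    · intro h
      simp only [words, Finset.mem_image, Finset.mem_sigma, Finset.mem_range] at h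
      obtain ⟨⟨v, s, r⟩, ⟨hv, hs, hr⟩, rfl⟩ := h
      simp only at hv hs hr ⊢
      obtain ⟨hc, ha⟩ := ih.1 hv
      have hs' := (le_descPrefix_iff v s).1 (by omega)
      have e : (v.take s).take r ++ (v.take s).drop r ++ v.drop s = v := by
        rw [List.take_append_drop, List.take_append_drop]
      have hm := hlt hc
      refine ⟨fun a => ?_, ?_⟩
      · have h1 := hc a
        rw [← e] at h1
        simp only [List.count_append, insertTwo, List.count_cons] at h1 ⊢
        by_cases hak : k = a
        · subst hak; simp at h1 ⊢; omega
        · simp only [beq_iff_eq, hak, if_false]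
          have : a < k + 1 ↔ a < k := by omega
          simp only [this]; omega
      · rw [insertTwo, avoids123_insert_iff, e, List.take_append_drop]
        · exact ⟨ha, hs'.2⟩
        · exact fun a h => hm a (List.mem_of_mem_take (List.mem_of_mem_take h))
        · exact fun a h => hm a (List.mem_of_mem_take (List.mem_of_mem_drop h))
        · exact fun a h => hm a (List.mem_of_mem_drop h)
    · rintro ⟨hc, ha⟩
      have hk : w.count k = 2 := by simpa using hc k
      obtain ⟨x, w', rfl, hx⟩ := List.eq_append_cons_of_mem
        (List.count_pos_iff.1 (by omega : 0 < w.count k))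
      have hk' : w'.count k = 1 := by
        simpa [List.count_append, List.count_eq_zero.2 hx] using hk
      obtain ⟨y, z, rfl, hy⟩ := List.eq_append_cons_of_mem
        (List.count_pos_iff.1 (by omega : 0 < w'.count k))
      have hz : z.count k = 0 := by
        simpa [List.count_append, List.count_eq_zero.2 hy] using hk'
      have hcv : ∀ a, (x ++ y ++ z).count a = if a < k then 2 else 0 := by
        intro a
        have h1 := hc a
        simp only [List.count_append, List.count_cons] at h1 ⊢
        by_cases hak : k = a
        · subst hak
          simp [hz, List.count_eq_zero.2 hx, List.count_eq_zero.2 hy]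
        · simp only [beq_iff_eq, hak, if_false] at h1
          have : a < k + 1 ↔ a < k := by omega
          simp only [this] at h1; omega
      have hm := hlt hcv
      rw [avoids123_insert_iff (fun a h => hm a (by simp [h])) (fun a h => hm a (by simp [h]))
        (fun a h => hm a (by simp [h]))] at ha
      simp only [words, Finset.mem_image, Finset.mem_sigma, Finset.mem_range]
      refine ⟨⟨x ++ y ++ z, (x ++ y).length, x.length⟩,
        ⟨ih.2 ⟨hcv, ha.1⟩, Nat.lt_succ_of_le ((le_descPrefix_iff _ _).2 ?_), ?_⟩, ?_⟩
      · exact ⟨by simp, by rw [List.take_left']; exacts [ha.2, rfl]⟩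
      · simp
      · simp only [insertTwo]
        rw [List.take_left' rfl, List.drop_left' rfl, List.take_left' rfl, List.drop_left' rfl]

theorem lt_of_mem_words {k : ℕ} {w : List ℕ} (hw : w ∈ words k) {a : ℕ} (ha : a ∈ w) : a < k := by
  by_contra h
  have := (mem_words.1 hw).1 a
  rw [if_neg h] at this
  exact List.count_eq_zero.1 this ha

/-- A copy of `k` preceded by a smaller letter creates an ascent and ends the prefix just before it;
a copy at the very front lengthens the prefix by one. -/
theorem descPrefix_insertTwo {k : ℕ} {w : List ℕ} (hw : ∀ a ∈ w, a < k) {s r : ℕ}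
    (hs : s ≤ descPrefix w) (hr : r ≤ s) :
    descPrefix (insertTwo k w s r) =
      if r = 0 then (if s = 0 then descPrefix w + 2 else s + 1) else r := by
  obtain ⟨hl, hp⟩ := (le_descPrefix_iff w s).1 hs
  have hws : ∀ a ∈ w.take s, a < k := fun a h => hw a (List.mem_of_mem_take h)
  unfold insertTwo
  split_ifs with h0 h1
  · subst h0 h1
    simp only [List.take_zero, List.drop_zero, List.nil_append]
    rw [descPrefix_cons, descPrefix_cons fun a h => (hw a h).le]
    intro a h
    rcases List.mem_cons.1 h with rfl | h
    · exact le_rfl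
    · exact (hw a h).le
  · subst h0
    simp only [List.take_zero, List.drop_zero, List.nil_append]
    rw [descPrefix_cons, descPrefix_append_cons _ _ hp hws]
    · simp [hl]
    · intro h
      have := congrArg List.length h
      rw [List.length_take, List.length_nil] at this
      omega
    · intro a h
      simp only [List.mem_append, List.mem_cons] at h
      rcases h with h | rfl | h
      · exact (hws a h).le
      · exact le_rfl
      · exact (hw a (List.mem_of_mem_drop h)).le
  · rw [descPrefix_append_cons _ _ (hp.sublist (List.take_sublist _ _))
      (fun a h => hws a (List.mem_of_mem_take h))]
    · simp; omega
    · intro h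
      have := congrArg List.length h
      rw [List.length_take, List.length_take, List.length_nil] at this
      omega

theorem append_cons_inj {α : Type*} {k : α} {x x' l l' : List α} (hx : k ∉ x) (hx' : k ∉ x')
    (h : x ++ k :: l = x' ++ k :: l') : x = x' ∧ l = l' := by
  induction x generalizing x' with
  | nil =>
    rcases x' with _ | ⟨b, x'⟩
    · simpa using h
    · simp only [List.nil_append, List.cons_append, List.cons.injEq] at h
      exact absurd (by simp [h.1]) hx'
  | cons a x ih =>
    rcases x' with _ | ⟨b, x'⟩
    · simp only [List.nil_append, List.cons_append, List.cons.injEq] at h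
      exact absurd (by simp [h.1]) hx
    · simp only [List.cons_append, List.cons.injEq] at h
      obtain ⟨h1, h2⟩ := ih (fun h => hx (List.mem_cons_of_mem _ h))
        (fun h => hx' (List.mem_cons_of_mem _ h)) h.2
      exact ⟨by rw [h.1, h1], h2⟩

theorem sum_words_succ {M : Type*} [AddCommMonoid M] (k : ℕ) (f : ℕ → M) :
    ∑ w ∈ words (k + 1), f (descPrefix w) =
      ∑ w ∈ words k, ∑ s ∈ Finset.range (descPrefix w + 1), ∑ r ∈ Finset.range (s + 1),
        f (if r = 0 then (if s = 0 then descPrefix w + 2 else s + 1) else r) := by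
  rw [words, Finset.sum_image, Finset.sum_sigma]
  · refine Finset.sum_congr rfl fun w hw => ?_
    rw [Finset.sum_sigma]
    refine Finset.sum_congr rfl fun s hs => Finset.sum_congr rfl fun r hr => ?_
    rw [Finset.mem_range] at hs hr
    rw [descPrefix_insertTwo (fun a => lt_of_mem_words hw) (Nat.lt_succ_iff.1 hs)
      (Nat.lt_succ_iff.1 hr)]
  -- Injectivity: cutting at the two copies of `k`, which does not occur in `v`, recovers the three
  -- pieces. Their lengths recover `r` and `s`, because `s` is at most the length of `v`.
  · rintro ⟨v, s, r⟩ h ⟨v', s', r'⟩ h' e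
    simp only [Finset.coe_sigma, Set.mem_sigma_iff, Finset.mem_coe, Finset.mem_range] at h h'
    obtain ⟨hv, hs, hr⟩ := h
    obtain ⟨hv', hs', hr'⟩ := h'
    have hsv : s ≤ descPrefix v := Nat.lt_succ_iff.1 hs
    have hsv' : s' ≤ descPrefix v' := Nat.lt_succ_iff.1 hs'
    have hrs : r ≤ s := Nat.lt_succ_iff.1 hr
    have hrs' : r' ≤ s' := Nat.lt_succ_iff.1 hr'
    have hl := ((le_descPrefix_iff v s).1 hsv).1
    have hl' := ((le_descPrefix_iff v' s').1 hsv').1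
    have hn : k ∉ v := fun h => (lt_of_mem_words hv h).false
    have hn' : k ∉ v' := fun h => (lt_of_mem_words hv' h).false
    simp only [insertTwo] at e
    obtain ⟨e1, e2⟩ := append_cons_inj
      (fun h => hn (List.mem_of_mem_take (List.mem_of_mem_take h)))
      (fun h => hn' (List.mem_of_mem_take (List.mem_of_mem_take h))) e
    obtain ⟨e3, e4⟩ := append_cons_inj
      (fun h => hn (List.mem_of_mem_take (List.mem_of_mem_drop h)))
      (fun h => hn' (List.mem_of_mem_take (List.mem_of_mem_drop h))) e2
    have e5 : v.take s = v'.take s' := by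
      rw [← List.take_append_drop r (v.take s), e1, e3, List.take_append_drop]
    have e6 : v = v' := by
      rw [← List.take_append_drop s v, e5, e4, List.take_append_drop]
    have e7 : s = s' := by
      have := congrArg List.length e5
      rw [List.length_take, List.length_take] at this
      omega
    have e8 : r = r' := by
      have := congrArg List.length e1
      simp only [List.length_take] at this
      omega
    subst e6 e7 e8
    rfl

/-! ### Words and ordered partitions -/

theorem count_ofFn {α : Type*} [DecidableEq α] {n : ℕ} (f : Fin n → α) (a : α) :
    (List.ofFn f).count a = (Finset.univ.filter fun x => f x = a).card := by
  rw [← Multiset.coe_count, ← Fin.univ_val_map, Multiset.count_map, Finset.card_def,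
    Finset.filter_val]
  simp only [eq_comm]

theorem avoids123_ofFn_iff {n : ℕ} (f : Fin n → ℕ) :
    Avoids123 (List.ofFn f) ↔ ∀ x y z, x < y → y < z → f x < f y → ¬ f y < f z := by
  constructor
  · intro h x y z hxy hyz hf hf'
    refine h _ _ _ hf hf' ?_
    have h1 : [x, y, z].Sublist (List.finRange n) := by
      have hs : [x, y, z].Pairwise (· < ·) := by
        simp [hxy, hyz, hxy.trans hyz]
      exact List.sublist_of_subperm_of_pairwise
        (List.subperm_of_subset (hs.imp fun h => ne_of_lt h) fun a _ => List.mem_finRange a) hs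
        (List.pairwise_lt_finRange n)
    have h2 := h1.map f
    rwa [← List.ofFn_eq_map] at h2
  · intro h a b c hab hbc hs
    rw [List.ofFn_eq_map, List.sublist_map_iff] at hs
    obtain ⟨l, hl, he⟩ := hs
    rcases l with _ | ⟨x, _ | ⟨y, _ | ⟨z, _ | ⟨u, l⟩⟩⟩⟩ <;> simp at he
    obtain ⟨rfl, rfl, rfl⟩ := he
    have hp := (List.pairwise_lt_finRange n).sublist hl
    simp only [List.pairwise_cons, List.mem_cons, forall_eq_or_imp] at hp
    exact h x y z hp.1.1 hp.2.1.1 hab hbc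

/-- The partition whose `i`-th block is the set of positions of the letter `i` in `w`. -/
def blocksOf (n k : ℕ) (w : List ℕ) (i : Fin k) : Finset (Fin n) :=
  Finset.univ.filter fun x => w[(x : ℕ)]? = some (i : ℕ)

theorem mem_blocksOf_ofFn {n k : ℕ} (f : Fin n → ℕ) (i : Fin k) (x : Fin n) :
    x ∈ blocksOf n k (List.ofFn f) i ↔ f x = i := by
  simp [blocksOf]

theorem contains_pattern123_iff {n k : ℕ} {B : Fin k → Finset (Fin n)} {g : Fin n → Fin k}
    (hg : ∀ x i, x ∈ B i ↔ g x = i) :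
    Contains B pattern123 ↔ ¬ Avoids123 (List.ofFn fun x => (g x : ℕ)) := by
  rw [avoids123_ofFn_iff]
  push Not
  constructor
  · rintro ⟨i, b, hi, hb, ho⟩
    have hb' : ∀ j, g (b j) = i j := fun j => (hg _ _).1 (hb j)
    refine ⟨b 0, b 1, b 2, (ho 0 1).2 (by decide), (ho 1 2).2 (by decide), ?_, ?_⟩
    · rw [hb', hb']; exact hi (by decide)
    · rw [hb', hb']; exact hi (by decide)
  · rintro ⟨x, y, z, hxy, hyz, h1, h2⟩
    have hb : StrictMono ![x, y, z] := by
      rw [Fin.strictMono_iff_lt_succ]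
      intro i
      fin_cases i
      · exact hxy
      · exact hyz
    refine ⟨fun j => g (![x, y, z] j), ![x, y, z], ?_, fun j => (hg _ _).2 rfl, fun j l => ?_⟩
    · rw [Fin.strictMono_iff_lt_succ]
      intro i
      fin_cases i
      · exact h1
      · exact h2
    · exact hb.lt_iff_lt

theorem length_of_mem_words {k : ℕ} {w : List ℕ} (hw : w ∈ words k) : w.length = 2 * k := by
  have h := (Multiset.sum_count_eq_card (s := Finset.range k) (m := (w : Multiset ℕ))
    (fun a ha => Finset.mem_range.2 (lt_of_mem_words hw (by simpa using ha))))
  rw [Multiset.coe_card] at h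
  rw [← h, Finset.sum_congr rfl fun a ha => ?_, Finset.sum_const, Finset.card_range, smul_eq_mul,
    mul_comm]
  rw [Multiset.coe_count, (mem_words.1 hw).1, if_pos (Finset.mem_range.1 ha)]

theorem exists_ofFn_of_mem_words {n k : ℕ} (hn : n = 2 * k) {w : List ℕ} (hw : w ∈ words k) :
    ∃ g : Fin n → Fin k, w = List.ofFn fun x => (g x : ℕ) := by
  have hl : w.length = n := by rw [length_of_mem_words hw, hn]
  subst hl
  exact ⟨fun x => ⟨w.get x, lt_of_mem_words hw (List.get_mem _ _)⟩, (List.ofFn_get w).symm⟩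

theorem ofFn_mem_words_iff {n k : ℕ} (g : Fin n → Fin k) :
    (List.ofFn fun x => (g x : ℕ)) ∈ words k ↔
      (∀ i, (Finset.univ.filter fun x => g x = i).card = 2) ∧
        Avoids123 (List.ofFn fun x => (g x : ℕ)) := by
  rw [mem_words]
  refine and_congr ⟨fun h i => ?_, fun h a => ?_⟩ Iff.rfl
  · have := h i
    rw [count_ofFn, if_pos i.2] at this
    simpa only [Fin.val_inj] using this
  · rw [count_ofFn]
    split_ifs with ha
    · rw [← h ⟨a, ha⟩]
      simp only [Fin.ext_iff]
    · rw [Finset.card_eq_zero, Finset.filter_eq_empty_iff]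
      intro x _ hx
      exact ha (hx ▸ (g x).2)

theorem bijOn_blocksOf {n k : ℕ} (hn : n = 2 * k) :
    Set.BijOn (blocksOf n k) (words k) (avoiding n (fun _ : Fin k => 2) pattern123) := by
  refine ⟨fun w hw => ?_, fun w hw w' hw' h => ?_, fun B hB => ?_⟩
  · obtain ⟨g, rfl⟩ := exists_ofFn_of_mem_words hn hw
    obtain ⟨hc, ha⟩ := (ofFn_mem_words_iff g).1 hw
    have hg : ∀ x i, x ∈ blocksOf n k (List.ofFn fun x => (g x : ℕ)) i ↔ g x = i := by
      intro x i
      rw [mem_blocksOf_ofFn, Fin.val_inj]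
    have hcard : ∀ i, (blocksOf n k (List.ofFn fun x => (g x : ℕ)) i).card = 2 := by
      intro i
      rw [← hc i]
      congr 1
      ext x
      simp [hg]
    refine ⟨⟨fun i => ?_, fun i j hij => ?_, fun x => ⟨g x, (hg _ _).2 rfl⟩⟩, hcard, ?_⟩
    · rw [← Finset.card_pos, hcard]; norm_num
    · rw [Finset.disjoint_left]
      intro x hi hj
      exact hij (((hg _ _).1 hi).symm.trans ((hg _ _).1 hj))
    · rw [contains_pattern123_iff hg, not_not]
      exact ha
  · obtain ⟨g, rfl⟩ := exists_ofFn_of_mem_words hn hw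
    obtain ⟨g', rfl⟩ := exists_ofFn_of_mem_words hn hw'
    congr 1
    ext x
    have h1 : x ∈ blocksOf n k (List.ofFn fun x => (g x : ℕ)) (g x) := by
      rw [mem_blocksOf_ofFn]
    rw [h, mem_blocksOf_ofFn] at h1
    exact h1.symm
  · obtain ⟨hp, hc, ha⟩ := hB
    choose g hg using hp.cover
    have hg' : ∀ x i, x ∈ B i ↔ g x = i := by
      intro x i
      refine ⟨fun h => ?_, fun h => h ▸ hg x⟩
      by_contra hne
      exact (Finset.disjoint_left.1 (hp.disjoint _ _ hne)) (hg x) h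
    refine ⟨List.ofFn fun x => (g x : ℕ), ?_, ?_⟩
    · rw [contains_pattern123_iff hg', not_not] at ha
      refine (ofFn_mem_words_iff g).2 ⟨fun i => ?_, ha⟩
      refine Eq.trans ?_ (hc i)
      congr 1
      ext x
      simp [hg']
    · funext i
      ext x
      rw [mem_blocksOf_ofFn, hg', Fin.val_inj]

theorem opTwo_eq_card_words (k : ℕ) : opTwo k = (words k).card := by
  have h := bijOn_blocksOf (n := ∑ _ : Fin k, 2) (k := k) (by simp [mul_comm])
  rw [opTwo, op, ← h.image_eq, h.injOn.ncard_image, Set.ncard_coe_finset]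

/-! ### Recurrences for binomial sums of the prefix length -/

theorem sum_range_succ_choose_succ (s i : ℕ) :
    ∑ r ∈ Finset.range s, (r + 1).choose (i + 1) = (s + 1).choose (i + 2) := by
  induction s with
  | zero => simp [Nat.choose_eq_zero_of_lt]
  | succ s ih => rw [Finset.sum_range_succ, ih, Nat.choose_succ_succ' (s + 1), add_comm]

theorem sum_insertTwo {M : Type*} [AddCommMonoid M] (f : ℕ → M) (j : ℕ) :
    (∑ s ∈ Finset.range (j + 1), ∑ r ∈ Finset.range (s + 1),
        f (if r = 0 then (if s = 0 then j + 2 else s + 1) else r)) =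
      f (j + 2) + ∑ s ∈ Finset.range j, (f (s + 2) + ∑ r ∈ Finset.range (s + 1), f (r + 1)) := by
  rw [Finset.sum_range_succ', add_comm]
  congr 1
  · simp
  · refine Finset.sum_congr rfl fun s _ => ?_
    rw [Finset.sum_range_succ', add_comm]
    simp

/-- The sum over the words of the binomial coefficients `(descPrefix w).choose i`. -/
def chooseSum (k i : ℕ) : ℕ := ∑ w ∈ words k, (descPrefix w).choose i

theorem chooseSum_zero_right (k : ℕ) : chooseSum k 0 = opTwo k := by
  simp [chooseSum, opTwo_eq_card_words]

theorem chooseSum_zero_left (i : ℕ) : chooseSum 0 i = if i = 0 then 1 else 0 := by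
  rcases i with _ | i <;> simp [chooseSum, words, descPrefix]

theorem chooseSum_succ_zero (k : ℕ) :
    chooseSum (k + 1) 0 = chooseSum k 2 + 2 * chooseSum k 1 + chooseSum k 0 := by
  simp only [chooseSum]
  rw [sum_words_succ k fun n => n.choose 0]
  simp only [Finset.mul_sum, ← Finset.sum_add_distrib]
  refine Finset.sum_congr rfl fun w _ => ?_
  rw [sum_insertTwo fun n => n.choose 0]
  generalize descPrefix w = j
  simp only [Nat.choose_zero_right, Finset.sum_const, Finset.card_range, smul_eq_mul, mul_one,
    Nat.choose_one_right]
  induction j with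
  | zero => simp
  | succ j ih =>
    have e : (j + 1).choose 2 = j.choose 1 + j.choose 2 := Nat.choose_succ_succ' j 1
    rw [Finset.sum_range_succ, e, Nat.choose_one_right]
    omega

/-- Two hockey-stick summations. The correction at `i = 0` is the term `(s + 2).choose (i + 1)` that
would occur at `s = -1`. -/
theorem sum_insertTwo_choose_succ (i j : ℕ) :
    (∑ s ∈ Finset.range j, ((s + 2).choose (i + 1) +
        ∑ r ∈ Finset.range (s + 1), (r + 1).choose (i + 1))) + (if i = 0 then 1 else 0) =
      (j + 3).choose (i + 3) := by
  induction j with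
  | zero => rcases i with _ | i <;> simp [Nat.choose_eq_zero_of_lt]
  | succ j ih =>
    have e₁ : (j + 1 + 3).choose (i + 3) = (j + 3).choose (i + 2) + (j + 3).choose (i + 3) :=
      Nat.choose_succ_succ' (j + 3) (i + 2)
    have e₂ : (j + 3).choose (i + 2) = (j + 2).choose (i + 1) + (j + 2).choose (i + 2) :=
      Nat.choose_succ_succ' (j + 2) (i + 1)
    have e₃ : (j + 1 + 1).choose (i + 2) = (j + 2).choose (i + 2) := rfl
    rw [Finset.sum_range_succ, sum_range_succ_choose_succ (j + 1), e₁, e₂]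
    omega

theorem chooseSum_succ_one (k : ℕ) :
    chooseSum (k + 1) 1 =
      chooseSum k 3 + 3 * chooseSum k 2 + 4 * chooseSum k 1 + 2 * chooseSum k 0 := by
  simp only [chooseSum]
  rw [sum_words_succ k fun n => n.choose 1]
  simp only [Finset.mul_sum, ← Finset.sum_add_distrib]
  refine Finset.sum_congr rfl fun w _ => ?_
  rw [sum_insertTwo fun n => n.choose 1]
  generalize descPrefix w = j
  have h := sum_insertTwo_choose_succ 0 j
  simp only [zero_add, if_true] at h
  have e : (j + 3).choose 3 = j.choose 3 + 3 * j.choose 2 + 3 * j.choose 1 + 1 := by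
    simp only [Nat.choose_succ_succ', Nat.choose_zero_right]
    ring
  rw [e] at h
  simp only [Nat.choose_one_right, Nat.choose_zero_right] at h ⊢
  omega

/-- A word with prefix length `j` contributes `(j + 2).choose (i + 2) + (j + 3).choose (i + 4)`;
Pascal's rule expands this with coefficients 1, 3, 4, 3, 1. -/
theorem chooseSum_succ_add_two (k i : ℕ) :
    chooseSum (k + 1) (i + 2) =
      chooseSum k (i + 4) + 3 * chooseSum k (i + 3) + 4 * chooseSum k (i + 2) +
        3 * chooseSum k (i + 1) + chooseSum k i := by
  simp only [chooseSum]
  rw [sum_words_succ k fun n => n.choose (i + 2)]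
  simp only [Finset.mul_sum, ← Finset.sum_add_distrib]
  refine Finset.sum_congr rfl fun w _ => ?_
  rw [sum_insertTwo fun n => n.choose (i + 2)]
  generalize descPrefix w = j
  have h := sum_insertTwo_choose_succ (i + 1) j
  simp only [Nat.succ_ne_zero, if_false, add_zero] at h
  rw [h]
  simp only [Nat.choose_succ_succ']
  ring

/-! ### The kernel method and the algebraic equation -/

open PowerSeries

/-- Substitute `f - 1` into the binomial series of exponent 1/2, then fix the sign. -/
theorem exists_sq_eq_of_constantCoeff_eq_one (f : ℚ⟦X⟧) (hf : constantCoeff f = 1) :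
    ∃ g : ℚ⟦X⟧, constantCoeff g = 1 ∧ g ^ 2 = f := by
  have hs : HasSubst (f - 1) := HasSubst.of_constantCoeff_zero' (by simp [hf])
  have h := PowerSeries.binomialSeries_add (A := ℚ) (1 / 2 : ℚ) (1 / 2)
  have h1 : PowerSeries.binomialSeries ℚ (1 / 2 + 1 / 2 : ℚ) = 1 + X := by
    have := PowerSeries.binomialSeries_nat (R := ℚ) (A := ℚ) 1
    rw [add_halves]
    simpa using this
  have h2 : (PowerSeries.binomialSeries ℚ (1 / 2 : ℚ)).subst (f - 1) ^ 2 = f := by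
    rw [sq, ← subst_mul hs, ← h, h1, ← coe_substAlgHom hs, map_add, map_one, coe_substAlgHom,
      subst_X hs]
    ring
  have h3 : constantCoeff ((PowerSeries.binomialSeries ℚ (1 / 2 : ℚ)).subst (f - 1)) ^ 2 = 1 := by
    rw [← map_pow, h2, hf]
  rcases sq_eq_sq_iff_eq_or_eq_neg.1 (h3.trans (one_pow 2).symm) with h4 | h4
  · exact ⟨_, h4, h2⟩
  · exact ⟨-_, by rw [map_neg, h4, neg_neg], by rw [neg_sq, h2]⟩

/-- The parametrizing series `T`, algebraic over `ℚ(X)`. -/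
theorem exists_parameter : ∃ T : ℚ⟦X⟧, constantCoeff T = 1 ∧
    X * (3 + T ^ 2) ^ 2 = 4 * T ^ 2 * (1 - T ^ 2) := by
  obtain ⟨S, hS, hS2⟩ := exists_sq_eq_of_constantCoeff_eq_one (1 - 12 * X) (by simp)
  have h4 : constantCoeff (X + 4 : ℚ⟦X⟧) ≠ 0 := by simp [map_ofNat]
  obtain ⟨T, hT, hT2⟩ := exists_sq_eq_of_constantCoeff_eq_one
    ((2 - 3 * X + 2 * S) * (X + 4)⁻¹) (by simp [hS, map_ofNat]; norm_num)
  refine ⟨T, hT, ?_⟩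
  have hu := PowerSeries.mul_inv_cancel _ h4
  have h5 : (X + 4) * T ^ 2 = 2 - 3 * X + 2 * S := by
    rw [hT2]; linear_combination (2 - 3 * X + 2 * S) * hu
  have h6 : (X + 4 : ℚ⟦X⟧) ≠ 0 := fun h => h4 (by rw [h, map_zero])
  -- Multiplied by `X + 4`, the quadratic for `T ^ 2` becomes a completed square: `((X + 4) * T ^ 2
  -- - (2 - 3 * X)) ^ 2 = 4 * (1 - 12 * X)`.
  refine mul_left_cancel₀ h6 ?_
  linear_combination ((X + 4) * T ^ 2 - (2 - 3 * X) + 2 * S) * h5 + 4 * hS2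

/-- The sequence with initial terms `b₀`, `b₁` and recurrence
`b (i + 2) = s * b (i + 1) - p * b i`. -/
def kernelSeq {R : Type*} [CommRing R] (b₀ b₁ s p : R) : ℕ → R
  | 0 => b₀
  | 1 => b₁
  | i + 2 => s * kernelSeq b₀ b₁ s p (i + 1) - p * kernelSeq b₀ b₁ s p i

/-- The kernel `t * (λ^4 + 3λ^3 + 4λ^2 + 3λ + 1) - λ^2` is palindromic, so up to a scalar it is `λ^2
- sλ + p` times its reversal. Comparing coefficients gives `s * (1 + p) = -3 * p` and a relation
between `t` and `p`; the parameter is `T = (1 + p) / (1 - p)`. The values `b₀`, `b₁` solve the two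
boundary equations, and the last identity is the recurrence for any two consecutive terms `a`, `b`.
-/
theorem kernel_identities {K : Type*} [Field K] [CharZero K] {t T b₀ b₁ s p : K} (h0 : T ≠ 0)
    (h1 : 1 + T ≠ 0) (hD : 3 + T ^ 2 ≠ 0)
    (ht : t * (3 + T ^ 2) ^ 2 = 4 * T ^ 2 * (1 - T ^ 2))
    (hb₀ : 4 * T * b₀ = 3 + T ^ 2)
    (hb₁ : 8 * T ^ 2 * (1 + T) * b₁ = (1 - T) * (T + 3) * (3 + T ^ 2))
    (hs : 2 * T * s = 3 * (1 - T)) (hp : (1 + T) * p = -(1 - T)) :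
    b₀ = 1 + t * (s * b₁ - p * b₀ + 2 * b₁ + b₀) ∧
    b₁ = t * (s * (s * b₁ - p * b₀) - p * b₁ + 3 * (s * b₁ - p * b₀) + 4 * b₁ + 2 * b₀) ∧
    (t ^ 2 + 4 * t) * b₀ ^ 4 - (1 + 2 * t) * b₀ ^ 2 + 1 = 0 ∧
    ∀ a b : K, s * b - p * a =
      t * (s * (s * (s * b - p * a) - p * b) - p * (s * b - p * a) +
        3 * (s * (s * b - p * a) - p * b) + 4 * (s * b - p * a) + 3 * b + a) := by
  have ht' : t = 4 * T ^ 2 * (1 - T ^ 2) / (3 + T ^ 2) ^ 2 := by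
    rw [eq_div_iff (pow_ne_zero _ hD), ht]
  have hb₀' : b₀ = (3 + T ^ 2) / (4 * T) := by
    rw [eq_div_iff (by simpa using h0), ← hb₀]; ring
  have hb₁' : b₁ = (1 - T) * (T + 3) * (3 + T ^ 2) / (8 * T ^ 2 * (1 + T)) := by
    rw [eq_div_iff (by simp [h0, h1]), ← hb₁]; ring
  have hs' : s = 3 * (1 - T) / (2 * T) := by rw [eq_div_iff (by simpa using h0), ← hs]; ring
  have hp' : p = -(1 - T) / (1 + T) := by rw [eq_div_iff h1, ← hp]; ring
  subst ht' hb₀' hb₁' hs' hp'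
  refine ⟨?_, ?_, ?_, fun a b => ?_⟩ <;>
  · field_simp
    ring

theorem coeff_ofNat_mul (n m : ℕ) [m.AtLeastTwo] (f : ℚ⟦X⟧) :
    coeff n ((OfNat.ofNat m : ℚ⟦X⟧) * f) = (OfNat.ofNat m : ℚ) * coeff n f := by
  rw [← map_ofNat (C (R := ℚ)) m, coeff_C_mul]

/-- The factor `X` makes the coefficients of degree `k + 1`, for all `i` at once, depend only on
those of degree `k`. So the system has one solution, and no growth condition in `i` is needed. -/
theorem coeff_eq_chooseSum {b : ℕ → ℚ⟦X⟧} (h0 : b 0 = 1 + X * (b 2 + 2 * b 1 + b 0))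
    (h1 : b 1 = X * (b 3 + 3 * b 2 + 4 * b 1 + 2 * b 0))
    (h2 : ∀ i, b (i + 2) = X * (b (i + 4) + 3 * b (i + 3) + 4 * b (i + 2) + 3 * b (i + 1) + b i))
    (k i : ℕ) : coeff k (b i) = chooseSum k i := by
  have hc := @coeff_ofNat_mul
  induction k generalizing i with
  | zero =>
    rw [chooseSum_zero_left]
    rcases i with _ | _ | i
    · rw [h0]; simp
    · rw [h1]; simp
    · rw [h2]; simp
  | succ k ih =>
    rcases i with _ | _ | i
    · rw [h0, chooseSum_succ_zero, map_add, coeff_succ_X_mul]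
      simp [ih, hc, coeff_one]
    · rw [h1, chooseSum_succ_one, coeff_succ_X_mul]
      simp [ih, hc]
    · rw [h2, chooseSum_succ_add_two, coeff_succ_X_mul]
      simp [ih, hc]

theorem exists_injective_toField : ∃ (K : Type) (_ : Field K) (_ : CharZero K) (φ : ℚ⟦X⟧ →+* K),
    Function.Injective φ :=
  have h := IsFractionRing.injective ℚ⟦X⟧ (FractionRing ℚ⟦X⟧)
  have := charZero_of_injective_ringHom (C_injective (R := ℚ))
  ⟨FractionRing ℚ⟦X⟧, inferInstance, charZero_of_injective_ringHom h, _, h⟩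

/-- The generating function of `opTwo` satisfies a biquadratic equation. -/
theorem opTwo_algebraic {q : ℚ⟦X⟧} (hq : q = PowerSeries.mk fun k => (opTwo k : ℚ)) :
    (X ^ 2 + 4 * X) * q ^ 4 - (1 + 2 * X) * q ^ 2 + 1 = 0 := by
  obtain ⟨T, hT, ht⟩ := exists_parameter
  -- Since `T` has constant coefficient 1, all denominators below are units of the power series
  -- ring.
  have ex : ∀ d n : ℚ⟦X⟧, constantCoeff d ≠ 0 → ∃ x, d * x = n := fun d n hd =>
    ⟨d⁻¹ * n, by rw [← mul_assoc, PowerSeries.mul_inv_cancel _ hd, one_mul]⟩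
  obtain ⟨b₀, hb₀⟩ := ex (4 * T) (3 + T ^ 2) (by simp [hT, map_ofNat])
  obtain ⟨b₁, hb₁⟩ := ex (8 * T ^ 2 * (1 + T)) ((1 - T) * (T + 3) * (3 + T ^ 2))
    (by simp [hT, map_ofNat])
  obtain ⟨s, hs⟩ := ex (2 * T) (3 * (1 - T)) (by simp [hT, map_ofNat])
  obtain ⟨p, hp⟩ := ex (1 + T) (-(1 - T)) (by simp [hT])
  obtain ⟨K, _, _, φ, inj⟩ := exists_injective_toField
  have ne : ∀ d : ℚ⟦X⟧, constantCoeff d ≠ 0 → φ d ≠ 0 := by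
    intro d hd h
    rw [map_eq_zero_iff _ inj] at h
    exact hd (by rw [h, map_zero])
  have hD : 3 + φ T ^ 2 ≠ 0 := by
    have h : constantCoeff (3 + T ^ 2) ≠ 0 := by simp [hT, map_ofNat]; norm_num
    simpa [map_ofNat] using ne _ h
  have hK := kernel_identities (ne T (by simp [hT]))
    (by simpa [map_ofNat] using ne (1 + T) (by simp [hT]))
    hD
    (by simpa [map_ofNat] using congrArg φ ht) (by simpa [map_ofNat] using congrArg φ hb₀)
    (by simpa [map_ofNat] using congrArg φ hb₁)
    (by simpa [map_ofNat] using congrArg φ hs) (by simpa [map_ofNat] using congrArg φ hp)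
  obtain ⟨k0, k1, kA, k2⟩ := hK
  have hb : ∀ i, coeff i b₀ = (opTwo i : ℚ) := by
    intro i
    rw [← chooseSum_zero_right]
    refine coeff_eq_chooseSum (b := kernelSeq b₀ b₁ s p) (inj ?_) (inj ?_) (fun i => inj ?_) i 0
    · simpa [kernelSeq, map_ofNat] using k0
    · simpa [kernelSeq, map_ofNat] using k1
    · simpa [kernelSeq, map_ofNat] using
        k2 (φ (kernelSeq b₀ b₁ s p i)) (φ (kernelSeq b₀ b₁ s p (i + 1)))
  have : q = b₀ := by
    rw [hq]
    ext i
    rw [coeff_mk, hb]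
  rw [this]
  apply inj
  simpa [map_ofNat] using kA

/-! ### The differential equation -/

theorem ode_of_system {R : Type*} [CommRing R] [IsDomain R] {t q q₁ q₂ q₃ r r₁ r₂ : R}
    (hd : t * (t + 4) * (1 - 12 * t) ^ 2 ≠ 0)
    (h₁ : (1 - 12 * t) * q₁ = 3 * q + (3 * t - 2) * r)
    (h₂ : (1 - 12 * t) * q₂ = 15 * q₁ + 3 * r + (3 * t - 2) * r₁)
    (h₃ : (1 - 12 * t) * q₃ = 27 * q₂ + 6 * r₁ + (3 * t - 2) * r₂)
    (hr₁ : t * (t + 4) * (1 - 12 * t) * r₁ = (6 - 9 * t) * q + (27 * t ^ 2 + 33 * t - 6) * r)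
    (hr₂ : t * (t + 4) * (1 - 12 * t) * r₂ + (4 - 94 * t - 36 * t ^ 2) * r₁ =
      (6 - 9 * t) * q₁ - 9 * q + (27 * t ^ 2 + 33 * t - 6) * r₁ + (54 * t + 33) * r) :
    (28 * t ^ 3 - 329 * t ^ 4 - 84 * t ^ 5) * q₃ + (62 * t ^ 2 - 1215 * t ^ 3 - 522 * t ^ 4) * q₂ +
      (-(12 * t) - 540 * t ^ 2 - 612 * t ^ 3) * q₁ + (12 * t - 72 * t ^ 2) * q = 0 := by
  -- The leading coefficient is `7 * t ^ 2 * (t * (t + 4)) * (1 - 12 * t)`. Thus `h₃`, `hr₂`, `h₂`,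
  -- `hr₁`, `h₁` remove `q₃`, `r₂`, `q₂`, `r₁`, `q₁` in turn, and the remaining combination of `q`
  -- and `r` vanishes.
  refine (mul_eq_zero.1 ?_).resolve_left hd
  linear_combination (t * (t + 4) * (1 - 12 * t)) *
      (7 * t ^ 2 * (t * (t + 4)) * (1 - 12 * t) * h₃ + 7 * t ^ 2 * (3 * t - 2) * hr₂ +
        (189 * t ^ 2 * (t * (t + 4)) + (62 * t ^ 2 - 1215 * t ^ 3 - 522 * t ^ 4)) * h₂) +
    (42 * t ^ 2 * (t * (t + 4)) * (1 - 12 * t) +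
      7 * t ^ 2 * (3 * t - 2) * ((27 * t ^ 2 + 33 * t - 6) - (4 - 94 * t - 36 * t ^ 2)) +
     
      (189 * t ^ 2 * (t * (t + 4)) + (62 * t ^ 2 - 1215 * t ^ 3 - 522 * t ^ 4)) * (3 * t - 2)) * hr₁ +
    ((6 - 9 * t) * (7 * t ^ 2 * (3 * t - 2)) +
      15 * (189 * t ^ 2 * (t * (t + 4)) + (62 * t ^ 2 - 1215 * t ^ 3 - 522 * t ^ 4)) +
      (-(12 * t) - 540 * t ^ 2 - 612 * t ^ 3) * (1 - 12 * t)) * (t * (t + 4)) * h₁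

theorem derivative_mul (f g : ℚ⟦X⟧) :
    derivative ℚ (f * g) = f * derivative ℚ g + g * derivative ℚ f := by
  simp [Derivation.leibniz]

theorem opTwo_ode {q : ℚ⟦X⟧} (hq : q = PowerSeries.mk fun k => (opTwo k : ℚ)) :
    (28 * X ^ 3 - 329 * X ^ 4 - 84 * X ^ 5) * derivative ℚ (derivative ℚ (derivative ℚ q)) +
      (62 * X ^ 2 - 1215 * X ^ 3 - 522 * X ^ 4) * derivative ℚ (derivative ℚ q) +
      (-(12 * X) - 540 * X ^ 2 - 612 * X ^ 3) * derivative ℚ q + (12 * X - 72 * X ^ 2) * q = 0 := by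
  have hA := opTwo_algebraic hq
  have hd := derivative_mul
  have hX : derivative ℚ (X : ℚ⟦X⟧) = 1 := derivative_X
  have hn : ∀ (m : ℕ) [m.AtLeastTwo], derivative ℚ (OfNat.ofNat m : ℚ⟦X⟧) = 0 := by
    intro m _
    exact (derivative ℚ).map_natCast m
  have hq0 : q ≠ 0 := by
    rintro rfl
    simp at hA
  set q₁ := derivative ℚ q with hq₁
  set q₂ := derivative ℚ q₁ with hq₂
  set q₃ := derivative ℚ q₂ with hq₃
  set r₁ := derivative ℚ (q ^ 3) with hr₁
  set r₂ := derivative ℚ r₁ with hr₂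
  have hr₁' : r₁ = 3 * q ^ 2 * q₁ := by
    rw [hr₁, pow_succ, sq, hd, hd]; ring
  -- The derivative of the biquadratic equation, divided by `2 * q`.
  have h₀ : (1 + 2 * X - 2 * X * (X + 4) * q ^ 2) * q₁ = (X + 2) * q ^ 3 - q := by
    have := congrArg (derivative ℚ) hA
    simp only [map_add, map_sub, pow_succ, pow_zero, one_mul, hd, hX, hn, map_zero,
      Derivation.map_one_eq_zero, ← hq₁] at this
    have hz : CharZero ℚ⟦X⟧ := charZero_of_injective_ringHom (C_injective (R := ℚ))
    have h2 : (2 * q : ℚ⟦X⟧) ≠ 0 := mul_ne_zero two_ne_zero hq0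
    refine mul_left_cancel₀ h2 ?_
    linear_combination -this
  -- Modulo the biquadratic equation, the factor of `q₁` in `h₀` squares to the discriminant `(1 + 2
  -- * X) ^ 2 - 4 * X * (X + 4) = 1 - 12 * X`.
  have h₁ : (1 - 12 * X) * q₁ = 3 * q + (3 * X - 2) * q ^ 3 := by
    linear_combination (1 + 2 * X - 2 * X * (X + 4) * q ^ 2) * h₀ - 2 * (X + 2) * q * hA -
      4 * X * (X + 4) * q₁ * hA
  have hr : X * (X + 4) * (1 - 12 * X) * r₁ =
      (6 - 9 * X) * q + (27 * X ^ 2 + 33 * X - 6) * q ^ 3 := by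
    rw [hr₁']
    -- The equation `hA` reduces the resulting `q ^ 5` to `q` and `q ^ 3`.
    linear_combination 3 * q ^ 2 * X * (X + 4) * h₁ + 3 * (3 * X - 2) * q * hA
  have h₂ : (1 - 12 * X) * q₂ = 15 * q₁ + 3 * q ^ 3 + (3 * X - 2) * r₁ := by
    have := congrArg (derivative ℚ) h₁
    simp only [map_add, map_sub, hd, hX, hn, Derivation.map_one_eq_zero, ← hq₁, ← hr₁, ← hq₂]
      at this
    linear_combination this
  have h₃ : (1 - 12 * X) * q₃ = 27 * q₂ + 6 * r₁ + (3 * X - 2) * r₂ := by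
    have := congrArg (derivative ℚ) h₂
    simp only [map_add, map_sub, hd, hX, hn, Derivation.map_one_eq_zero, ← hq₂, ← hr₁, ← hr₂,
      ← hq₃] at this
    linear_combination this
  have hr' : X * (X + 4) * (1 - 12 * X) * r₂ + (4 - 94 * X - 36 * X ^ 2) * r₁ =
      (6 - 9 * X) * q₁ - 9 * q + (27 * X ^ 2 + 33 * X - 6) * r₁ + (54 * X + 33) * q ^ 3 := by
    have := congrArg (derivative ℚ) hr
    simp only [map_add, map_sub, hd, hX, hn, Derivation.map_one_eq_zero, ← hr₁, ← hr₂,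
      ← hq₁, sq (X : ℚ⟦X⟧)] at this
    linear_combination this
  have ne : ∀ d : ℚ⟦X⟧, constantCoeff d ≠ 0 → d ≠ 0 := fun d hd h => hd (by rw [h, map_zero])
  refine ode_of_system ?_ h₁ h₂ h₃ hr hr'
  exact mul_ne_zero (mul_ne_zero X_ne_zero (ne _ (by simp [map_ofNat])))
    (pow_ne_zero _ (ne _ (by simp)))

/-! ### Coefficient recurrence and the equation for `Q` -/

theorem coeff_X_mul_derivative (f : ℚ⟦X⟧) (n : ℕ) :
    coeff n (X * derivative ℚ f) = n * coeff n f := by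
  rcases n with _ | n
  · simp
  · rw [coeff_succ_X_mul, coeff_derivative]
    push_cast
    ring

theorem coeff_X_sq_mul_derivative (f : ℚ⟦X⟧) (n : ℕ) :
    coeff n (X ^ 2 * derivative ℚ (derivative ℚ f)) = n * (n - 1) * coeff n f := by
  have h : X ^ 2 * derivative ℚ (derivative ℚ f) =
      X * derivative ℚ (X * derivative ℚ f) - X * derivative ℚ f := by
    rw [derivative_mul, derivative_X]; ring
  rw [h, map_sub, coeff_X_mul_derivative, coeff_X_mul_derivative]
  ring

theorem coeff_X_cube_mul_derivative (f : ℚ⟦X⟧) (n : ℕ) :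
    coeff n (X ^ 3 * derivative ℚ (derivative ℚ (derivative ℚ f))) =
      n * (n - 1) * (n - 2) * coeff n f := by
  have h : X ^ 3 * derivative ℚ (derivative ℚ (derivative ℚ f)) =
      X * derivative ℚ (X ^ 2 * derivative ℚ (derivative ℚ f)) -
        2 * (X ^ 2 * derivative ℚ (derivative ℚ f)) := by
    rw [derivative_mul, sq, derivative_mul, derivative_X]; ring
  rw [h, map_sub, coeff_X_mul_derivative, coeff_ofNat_mul, coeff_X_sq_mul_derivative]
  ring

theorem opTwo_recurrence (k : ℕ) :
    2 * ((k : ℚ) + 2) * (2 * k + 5) * (7 * k + 5) * opTwo (k + 2) =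
      (329 * (k : ℚ) ^ 3 + 1215 * (k : ℚ) ^ 2 + 1426 * k + 528) * opTwo (k + 1) +
        6 * ((k : ℚ) + 1) * (2 * k + 1) * (7 * k + 12) * opTwo k := by
  obtain ⟨q, hq⟩ : ∃ q : ℚ⟦X⟧, q = PowerSeries.mk fun k => (opTwo k : ℚ) := ⟨_, rfl⟩
  have hc : ∀ n, coeff n q = opTwo n := fun n => by rw [hq, coeff_mk]
  obtain ⟨F₁, hF₁⟩ : ∃ F, F = X * derivative ℚ q := ⟨_, rfl⟩
  obtain ⟨F₂, hF₂⟩ : ∃ F, F = X ^ 2 * derivative ℚ (derivative ℚ q) := ⟨_, rfl⟩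
  obtain ⟨F₃, hF₃⟩ : ∃ F, F = X ^ 3 * derivative ℚ (derivative ℚ (derivative ℚ q)) := ⟨_, rfl⟩
  -- Each `X ^ j` times a `j`-th derivative acts diagonally on coefficients, so only the shifts by
  -- 0, 1 and 2 remain.
  have e : (28 * F₃ + 62 * F₂ - 12 * F₁) + X * (12 * q - 329 * F₃ - 1215 * F₂ - 540 * F₁) -
      X ^ 2 * (84 * F₃ + 522 * F₂ + 612 * F₁ + 72 * q) = 0 := by
    rw [hF₁, hF₂, hF₃]
    linear_combination opTwo_ode hq
  have h := congrArg (coeff (k + 2)) e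
  have hn := @coeff_ofNat_mul
  have h₁ : ∀ n, coeff n F₁ = n * opTwo n := fun n => by rw [hF₁, coeff_X_mul_derivative, hc]
  have h₂ : ∀ n, coeff n F₂ = n * (n - 1) * opTwo n := fun n => by
    rw [hF₂, coeff_X_sq_mul_derivative, hc]
  have h₃ : ∀ n, coeff n F₃ = n * (n - 1) * (n - 2) * opTwo n := fun n => by
    rw [hF₃, coeff_X_cube_mul_derivative, hc]
  rw [map_sub, map_add, coeff_X_pow_mul, coeff_succ_X_mul] at h
  simp only [map_add, map_sub, hn, h₁, h₂, h₃, hc, map_zero] at h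
  push_cast at h
  linear_combination h

theorem opTwo_zero : opTwo 0 = 1 := by
  rw [← chooseSum_zero_right, chooseSum_zero_left, if_pos rfl]

theorem opTwo_one : opTwo 1 = 1 := by
  rw [← chooseSum_zero_right, chooseSum_succ_zero]
  simp [chooseSum_zero_left]

theorem coeff_Q_two_mul (k : ℕ) : coeff (2 * k) Q = opTwo k := by
  simp [Q]

theorem coeff_Q_of_odd {m : ℕ} (hm : ¬ Even m) : coeff m Q = 0 := by
  simp [Q, hm]

theorem Q_ode :
    (C (21 / 2 : ℚ) * X ^ 7 + C (329 / 8 : ℚ) * X ^ 5 - C (7 / 2 : ℚ) * X ^ 3) *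
          derivative ℚ (derivative ℚ (derivative ℚ Q))
        + (C (99 : ℚ) * X ^ 6 + C (1443 / 8 : ℚ) * X ^ 4 - C (5 : ℚ) * X ^ 2) *
          derivative ℚ (derivative ℚ Q)
        + (C (207 : ℚ) * X ^ 5 + C (717 / 8 : ℚ) * X ^ 3 + C (11 : ℚ) * X) *
          derivative ℚ Q
        + (C (72 : ℚ) * X ^ 4 - C (12 : ℚ) * X ^ 2) * Q = 0 := by
  obtain ⟨F₁, hF₁⟩ : ∃ F, F = X * derivative ℚ Q := ⟨_, rfl⟩
  obtain ⟨F₂, hF₂⟩ : ∃ F, F = X ^ 2 * derivative ℚ (derivative ℚ Q) := ⟨_, rfl⟩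
  obtain ⟨F₃, hF₃⟩ : ∃ F, F = X ^ 3 * derivative ℚ (derivative ℚ (derivative ℚ Q)) := ⟨_, rfl⟩
  have h₁ : ∀ n, coeff n F₁ = n * coeff n Q := fun n => by rw [hF₁, coeff_X_mul_derivative]
  have h₂ : ∀ n, coeff n F₂ = n * (n - 1) * coeff n Q := fun n => by
    rw [hF₂, coeff_X_sq_mul_derivative]
  have h₃ : ∀ n, coeff n F₃ = n * (n - 1) * (n - 2) * coeff n Q := fun n => by
    rw [hF₃, coeff_X_cube_mul_derivative]
  have e : X ^ 4 * (C (21 / 2 : ℚ) * F₃ + C (99 : ℚ) * F₂ + C (207 : ℚ) * F₁ + C (72 : ℚ) * Q) +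
      X ^ 2 * (C (329 / 8 : ℚ) * F₃ + C (1443 / 8 : ℚ) * F₂ + C (717 / 8 : ℚ) * F₁ -
        C (12 : ℚ) * Q) +
      (C (11 : ℚ) * F₁ - C (7 / 2 : ℚ) * F₃ - C (5 : ℚ) * F₂) = 0 := by
    ext m
    simp only [map_add, map_sub, coeff_X_pow_mul', coeff_C_mul, h₁, h₂, h₃, map_zero]
    rcases Nat.even_or_odd m with hm | hm
    · obtain ⟨n, rfl⟩ := hm.two_dvd
      -- Degrees 0 and 2 are checked by hand, since the shift by 4 does not reach them; degree `2 *
      -- (n + 2)` is the recurrence at `n`.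
      rcases n with _ | _ | n
      · simp
      · have h0 : coeff 0 Q = 1 := by simpa [opTwo_zero] using coeff_Q_two_mul 0
        have h1 : coeff 2 Q = 1 := by simpa [opTwo_one] using coeff_Q_two_mul 1
        norm_num [h0, h1]
      · have e4 : 2 * (n + 1 + 1) - 4 = 2 * n := by omega
        have e2 : 2 * (n + 1 + 1) - 2 = 2 * (n + 1) := by omega
        rw [if_pos (by omega), if_pos (by omega), e4, e2, coeff_Q_two_mul, coeff_Q_two_mul,
          coeff_Q_two_mul]
        push_cast
        linear_combination -opTwo_recurrence n
    · have z : ∀ i, Even i → i ≤ m → coeff (m - i) Q = 0 := fun i hi hle =>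
        coeff_Q_of_odd (Nat.not_even_iff_odd.2 (Nat.Odd.sub_even hle hm hi))
      rw [coeff_Q_of_odd (Nat.not_even_iff_odd.2 hm)]
      split_ifs with h4 h2 h2
      · rw [z 4 (by decide) h4, z 2 (by decide) h2]; ring
      · omega
      · rw [z 2 (by decide) h2]; ring
      · ring
  rw [hF₁, hF₂, hF₃] at e
  linear_combination e

end OrderedSetPartition

open OrderedSetPartition PowerSeries in
theorem mainTheorem6 :
    ((C (21 / 2 : ℚ) * X ^ 7 + C (329 / 8 : ℚ) * X ^ 5 - C (7 / 2 : ℚ) * X ^ 3) *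
          derivative ℚ (derivative ℚ (derivative ℚ Q))
        + (C (99 : ℚ) * X ^ 6 + C (1443 / 8 : ℚ) * X ^ 4 - C (5 : ℚ) * X ^ 2) *
          derivative ℚ (derivative ℚ Q)
        + (C (207 : ℚ) * X ^ 5 + C (717 / 8 : ℚ) * X ^ 3 + C (11 : ℚ) * X) *
          derivative ℚ Q
        + (C (72 : ℚ) * X ^ 4 - C (12 : ℚ) * X ^ 2) * Q = 0) ∧
    ∀ k : ℕ,
      (opTwo (k + 2) : ℚ) =
        (329 * (k : ℚ) ^ 3 + 1215 * (k : ℚ) ^ 2 + 1426 * (k : ℚ) + 528) /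
            (2 * ((k : ℚ) + 2) * (2 * (k : ℚ) + 5) * (7 * (k : ℚ) + 5)) * (opTwo (k + 1) : ℚ)
          + 3 * ((k : ℚ) + 1) * (2 * (k : ℚ) + 1) * (7 * (k : ℚ) + 12) /
            (((k : ℚ) + 2) * (2 * (k : ℚ) + 5) * (7 * (k : ℚ) + 5)) * (opTwo k : ℚ) := by
  refine ⟨Q_ode, fun k => ?_⟩
  have h := opTwo_recurrence k
  have h₁ : (k : ℚ) + 2 ≠ 0 := by positivity
  have h₂ : 2 * (k : ℚ) + 5 ≠ 0 := by positivity
  have h₃ : 7 * (k : ℚ) + 5 ≠ 0 := by positivity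
  field_simp
  linear_combination h
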